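/- \textbf{Setting.} For $p\in(0,1)$ let $X_1,X_2,\dots$ be i.i.d. Bernoulli random variables with parameter $p$, and let $U_1,U_2,\dots$ be i.i.d. random variables uniformly distributed on $(0,1)$ and independent of the $X_i$. A (possibly randomized) sequential algorithm consists of measurable functions $\tau_n,\gamma_n:(\{0,1\}\times\mathbb R)^n\to\{0,1\}$, $n\ge 1$, not depending on $p$. Its stopping time is $$N=\min\{n\ge 1:\ \tau_n(X_1,U_1;\dots;X_n,U_n)=1\}$$ ($N=\infty$ if there is no such $n$), and its output is $Y=\gamma_N(X_1,U_1;\dots;X_N,U_N)$ when $N<\infty$. (The algorithm is non-randomized if $\tau_n,\gamma_n$ do not depend on the $U_i$.) For $S\subseteq(0,1)$ and $f:S\to(0,1)$, the algorithm is a Bernoulli factory for $f$ if, for every $p\in S$, $N$ is almost surely finite and $Y$ is a Bernoulli variable with parameter $f(p)$. It is fast if for every $p\in S$ there are $A>0$ and $\beta<1$, possibly depending on $p$, such that $\Pr[N>n]\le A\beta^n$ for all integers $n\ge 0$. \textbf{Theorem.} Let $S\subseteq(0,1)$ be open and let $f:S\to(0,1)$ be differentiable. Then every fast, possibly randomized,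 Bernoulli factory for $f$ satisfies, for all $p\in S$, $$\mathbb E[N]\ \ge\ \bigl(f'(p)\bigr)^2\,\frac{p(1-p)}{f(p)\,(1-f(p))},$$ where $\mathbb E[N]$ is the expected number of inputs when the input sequence has parameter $p$. -/

import Mathlib

open MeasureTheory ProbabilityTheory
open scoped ENNReal unitInterval

namespace BernoulliFactory

/-- The uniform distribution on `(0,1)`. -/
noncomputable def uniform01 : Measure ℝ := volume.restrict (Set.Ioo (0 : ℝ) 1)

instance : IsProbabilityMeasure uniform01 :=
  ⟨by simp [uniform01]⟩

/-- The joint law of the i.i.d. sequence of pairs `(X_i, U_i)`: `X_i` is Bernoulli with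
parameter `p` (`true` is the value `1`, `false` is the value `0`), `U_i` is uniform on `(0,1)`,
and all these variables are independent. The coordinate `ω i` of a sample point
`ω : ℕ → Bool × ℝ` is the pair number `i + 1`. -/
noncomputable def inputLaw (p : I) : Measure (ℕ → Bool × ℝ) :=
  Measure.infinitePi fun _ : ℕ => (bernoulliMeasure true false p).prod uniform01

/-- The first `n` pairs `(x_1, u_1), …, (x_n, u_n)` of a realization. -/
def initial (ω : ℕ → Bool × ℝ) (n : ℕ) : Fin n → Bool × ℝ := fun i => ω i

/-- A (possibly randomized) sequential algorithm producing one bit: measurable stopping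
functions `τ_n` and measurable output functions `γ_n` of `(x_1, u_1), …, (x_n, u_n)`. Only the
indices `n ≥ 1` are used. The algorithm is non-randomized if these functions ignore the `u_i`. -/
structure Algorithm where
  /-- the stopping functions `τ_n` (`true` means: halt here) -/
  tau : (n : ℕ) → (Fin n → Bool × ℝ) → Bool
  /-- the output functions `γ_n` -/
  gamma : (n : ℕ) → (Fin n → Bool × ℝ) → Bool
  measurable_tau : ∀ n, Measurable (tau n)
  measurable_gamma : ∀ n, Measurable (gamma n)

namespace Algorithm

/-- The stopping time `N`: the smallest `n ≥ 1` with `τ_n = 1`, or `∞` if there is none. -/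
noncomputable def stopTime (B : Algorithm) (ω : ℕ → Bool × ℝ) : ℕ∞ :=
  ⨅ (n : ℕ) (_ : 1 ≤ n ∧ B.tau n (initial ω n) = true), (n : ℕ∞)

/-- The output `Y = γ_N(X_1, U_1; …; X_N, U_N)`. On the event `N = ∞`, which has probability `0`
for a Bernoulli factory, the value is irrelevant. -/
noncomputable def output (B : Algorithm) (ω : ℕ → Bool × ℝ) : Bool :=
  B.gamma (B.stopTime ω).toNat (initial ω (B.stopTime ω).toNat)

/-- `B` is a Bernoulli factory for `f` on `S`: for every parameter `p ∈ S` of the input, `N` is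
almost surely finite and the output `Y` is a Bernoulli variable with parameter `f p`. The
algorithm itself does not depend on `p`. -/
def IsFactory (B : Algorithm) (S : Set ℝ) (f : ℝ → ℝ) : Prop :=
  ∀ p : I, (p : ℝ) ∈ S →
    (∀ᵐ ω ∂inputLaw p, B.stopTime ω < ⊤) ∧
    (inputLaw p).real {ω | B.output ω = true} = f p

/-- `B` is fast on `S`: for each `p ∈ S` the distribution of `N` has an exponential tail, with
constants that may depend on `p`. -/
def IsFast (B : Algorithm) (S : Set ℝ) : Prop :=
  ∀ p : I, (p : ℝ) ∈ S → ∃ A β : ℝ, 0 < A ∧ β < 1 ∧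
    ∀ n : ℕ, (inputLaw p).real {ω | (n : ℕ∞) < B.stopTime ω} ≤ A * β ^ n

/-- The mean number of inputs `E[N]` when the parameter of the input is `p`. -/
noncomputable def meanInputs (B : Algorithm) (p : I) : ℝ≥0∞ :=
  ∫⁻ ω, (B.stopTime ω : ℝ≥0∞) ∂inputLaw p

end Algorithm

end BernoulliFactory

/-!
Fix `p` with `E[N] < ∞` and compare it with a slightly larger parameter `q`. Let `L k` be the
likelihood ratio of the first `k` inputs for `q` against `p`. Under `p` it is a martingale, and what
it does after time `N` does not correlate with an event `E` known at that time, so if `E` is decided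
within `m` inputs then `Q(E) - P(E)` is the covariance of `1_E` and `L (min N m) - 1`. The
increments of `L` are orthogonal, hence the variance of `L (min N m)` is at most
`(q - p)² / (p (1 - p)) * (q / p) ^ (2 m) * E[N]`, and the Cauchy–Schwarz inequality bounds
`(Q(E) - P(E))²` by this quantity times `P(E) (1 - P(E))`.

Take for `E` the event that the algorithm has answered `1` within `m` inputs, divide by `(q - p)²`
and let `m → ∞`, with `q = q m` tending to `p`. The factor `(q / p) ^ (2 m)` tends to `1` if
`m (q - p) → 0`, and truncating at time `m` costs nothing if `P(N > m) / (q - p) → 0`. Both can be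
achieved at once because `E[N] < ∞` forces `m P(N > m) → 0`.
-/

open Filter Topology

namespace BernoulliFactory

section Probability

variable {Ω : Type*} [MeasurableSpace Ω] {P : Measure Ω}

lemma sq_covariance_le [IsFiniteMeasure P] {X Y : Ω → ℝ} (hX : MemLp X 2 P) (hY : MemLp Y 2 P) :
    cov[X, Y; P] ^ 2 ≤ Var[X; P] * Var[Y; P] := by
  have hquad (t : ℝ) : 0 ≤ Var[X; P] * (t * t) + 2 * cov[X, Y; P] * t + Var[Y; P] := by
    have h := variance_nonneg (t • X + Y) P
    rw [variance_add (hX.const_smul t) hY, variance_smul, covariance_smul_left] at h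
    linarith
  have hdiscrim := discrim_le_zero hquad
  rw [discrim] at hdiscrim
  linarith

lemma variance_indicator_one [IsProbabilityMeasure P] {A : Set Ω} (hA : MeasurableSet A) :
    Var[A.indicator 1; P] = P.real A * (1 - P.real A) := by
  have hsq : (A.indicator 1 : Ω → ℝ) ^ 2 = A.indicator 1 := by
    ext ω
    by_cases h : ω ∈ A <;> simp [h]
  have hL2 : MemLp (A.indicator (1 : Ω → ℝ)) 2 P := memLp_indicator_const 2 hA 1 (by simp)
  rw [variance_eq_sub hL2, hsq, integral_indicator_one hA]
  ring

lemma sum_measure_lt_le_lintegral (P : Measure Ω) (T : Ω → ℕ∞)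
    (hT : ∀ k : ℕ, MeasurableSet {ω | (k : ℕ∞) < T ω}) (m : ℕ) :
    ∑ k ∈ Finset.range m, P {ω | (k : ℕ∞) < T ω} ≤ ∫⁻ ω, (T ω : ℝ≥0∞) ∂P := by
  have hcount (n : ℕ∞) : ∑ k ∈ Finset.range m, (if (k : ℕ∞) < n then 1 else 0 : ℝ≥0∞) ≤ n := by
    rcases eq_or_ne n ⊤ with rfl | hn
    · simp
    · lift n to ℕ using hn
      simp only [Nat.cast_lt, Finset.sum_boole, ENat.toENNReal_coe]
      exact_mod_cast (Finset.card_le_card fun k => by simp).trans_eq (Finset.card_range n)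
  calc ∑ k ∈ Finset.range m, P {ω | (k : ℕ∞) < T ω}
      = ∫⁻ ω, ∑ k ∈ Finset.range m, {ω | (k : ℕ∞) < T ω}.indicator 1 ω ∂P := by
        rw [lintegral_finsetSum _ fun k _ => measurable_one.indicator (hT k)]
        simp only [lintegral_indicator_one (hT _)]
    _ ≤ ∫⁻ ω, (T ω : ℝ≥0∞) ∂P := lintegral_mono fun ω => by
        simpa [Set.indicator_apply] using hcount (T ω)

lemma sum_measureReal_lt_le_toReal [IsFiniteMeasure P] {T : Ω → ℕ∞}
    (hT : ∀ k : ℕ, MeasurableSet {ω | (k : ℕ∞) < T ω}) (hfin : ∫⁻ ω, (T ω : ℝ≥0∞) ∂P ≠ ∞) (m : ℕ) :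
    ∑ k ∈ Finset.range m, P.real {ω | (k : ℕ∞) < T ω} ≤ (∫⁻ ω, (T ω : ℝ≥0∞) ∂P).toReal := by
  simp only [measureReal_def]
  rw [← ENNReal.toReal_sum fun _ _ => measure_ne_top _ _]
  exact ENNReal.toReal_mono hfin (sum_measure_lt_le_lintegral P T hT m)

lemma tendsto_add_one_mul_measureReal_lt {T : Ω → ℕ∞}
    (hT : ∀ k : ℕ, MeasurableSet {ω | (k : ℕ∞) < T ω}) (hfin : ∫⁻ ω, (T ω : ℝ≥0∞) ∂P ≠ ∞) :
    Tendsto (fun m : ℕ => ((m : ℝ) + 1) * P.real {ω | (m : ℕ∞) < T ω}) atTop (𝓝 0) := by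
  have htail : Tendsto (fun m : ℕ => P {ω | (m : ℕ∞) < T ω}) atTop (𝓝 0) :=
    ENNReal.tendsto_atTop_zero_of_tsum_ne_top <| ne_top_of_le_ne_top hfin <|
      ENNReal.tsum_le_of_sum_range_le (sum_measure_lt_le_lintegral P T hT)
  have hmarkov (m : ℕ) : ((m : ℝ≥0∞) + 1) * P {ω | (m : ℕ∞) < T ω} ≤
      ∫⁻ ω in {ω | (m : ℕ∞) < T ω}, (T ω : ℝ≥0∞) ∂P := by
    rw [← setLIntegral_const]
    refine setLIntegral_mono' (hT m) fun ω hω => ?_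
    simpa using ENat.toENNReal_mono (Order.add_one_le_of_lt hω)
  have hlim := tendsto_of_tendsto_of_tendsto_of_le_of_le tendsto_const_nhds
    (tendsto_setLIntegral_zero hfin htail) (fun _ => zero_le) hmarkov
  simpa [measureReal_def, Function.comp_def, ENNReal.toReal_add] using
    (ENNReal.tendsto_toReal ENNReal.zero_ne_top).comp hlim

end Probability

section ProductDensity

variable {ι : Type*} [Fintype ι] {X : ι → Type*} [∀ i, MeasurableSpace (X i)]
  {μ : ∀ i, Measure (X i)} [∀ i, IsProbabilityMeasure (μ i)]
  {f : ∀ i, X i → ℝ≥0∞}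

lemma lintegral_pi_prod (hf : ∀ i, Measurable (f i)) :
    ∫⁻ x, ∏ i, f i (x i) ∂Measure.pi μ = ∏ i, ∫⁻ x, f i x ∂μ i := by
  rw [lintegral_prod_eq_prod_lintegral_of_indepFun Finset.univ _
    (iIndepFun_pi fun i => (hf i).aemeasurable) fun i => (hf i).comp (measurable_pi_apply i)]
  exact Finset.prod_congr rfl fun i _ => (measurePreserving_eval μ i).lintegral_comp (hf i)

lemma pi_withDensity (hf : ∀ i, Measurable (f i))
    [∀ i, SigmaFinite ((μ i).withDensity (f i))] :
    (Measure.pi μ).withDensity (fun x => ∏ i, f i (x i)) =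
      Measure.pi fun i => (μ i).withDensity (f i) := by
  refine (Measure.pi_eq fun s hs => ?_).symm
  have hindicator (x : ∀ i, X i) : (Set.univ.pi s).indicator (fun x => ∏ i, f i (x i)) x =
      ∏ i, (s i).indicator (f i) (x i) := by
    by_cases hx : x ∈ Set.univ.pi s
    · rw [Set.indicator_of_mem hx]
      exact Finset.prod_congr rfl fun i _ => (Set.indicator_of_mem (hx i trivial) _).symm
    · obtain ⟨i, hi⟩ : ∃ i, x i ∉ s i := by simpa using hx
      rw [Set.indicator_of_notMem hx,
        Finset.prod_eq_zero (Finset.mem_univ i) (Set.indicator_of_notMem hi _)]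
  rw [withDensity_apply _ (.univ_pi hs), ← lintegral_indicator (.univ_pi hs)]
  simp only [hindicator, withDensity_apply _ (hs _), ← lintegral_indicator (hs _)]
  exact lintegral_pi_prod fun i => (hf i).indicator (hs i)

end ProductDensity

section IndependentSequences

variable {X : Type*} [MeasurableSpace X]

/-- The law of an independent sequence of observations with common law `μ`. -/
noncomputable abbrev iidLaw (μ : Measure X) : Measure (ℕ → X) :=
  Measure.infinitePi fun _ : ℕ => μ

variable (X) in
/-- The filtration of the observations. The σ-algebra at time `k` is generated by the first `k`
coordinates `ω 0, …, ω (k - 1)`, so that `ω k` is independent of it. -/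
def past : Filtration ℕ (MeasurableSpace.pi : MeasurableSpace (ℕ → X)) where
  seq k := cylinderEvents (Set.Iio k)
  mono' _ _ h := cylinderEvents_mono (Set.Iio_subset_Iio h)
  le' _ := cylinderEvents_le_pi

lemma measurable_past_eval {i k : ℕ} (h : i < k) :
    Measurable[past X k] fun ω : ℕ → X => ω i :=
  measurable_cylinderEvent_apply h

lemma past_eq_comap_restrict (k : ℕ) :
    past X k = MeasurableSpace.comap (Finset.range k).restrict MeasurableSpace.pi := by
  change ⨆ i ∈ Set.Iio k, MeasurableSpace.comap (fun ω : ℕ → X => ω i) inferInstance = _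
  simp only [MeasurableSpace.pi, MeasurableSpace.comap_iSup, MeasurableSpace.comap_comp,
    iSup_subtype, Finset.mem_range, Set.mem_Iio]
  rfl

variable {μ : Measure X} [IsProbabilityMeasure μ] {k : ℕ} {g : (ℕ → X) → ℝ} {φ : X → ℝ}

lemma indepFun_past_eval (hg : Measurable[past X k] g) (hφ : Measurable φ) :
    IndepFun g (fun ω => φ (ω k)) (iidLaw μ) := by
  have hiid : iIndepFun (fun (i : ℕ) (ω : ℕ → X) => ω i) (iidLaw μ) :=
    iIndepFun_infinitePi (X := fun _ x => x) fun _ => measurable_id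
  have hpast : Indep (past X k) (MeasurableSpace.comap (fun ω : ℕ → X => ω k) inferInstance)
      (iidLaw μ) := by
    simpa using! indep_iSup_of_disjoint (fun i => (measurable_pi_apply i).comap_le) hiid
      (S := Set.Iio k) (T := {k}) (by simp)
  exact indep_of_indep_of_le_left
    (indep_of_indep_of_le_right hpast (hφ.comp (comap_measurable _)).comap_le) hg.comap_le

lemma integral_past_mul_eval (hg : Measurable[past X k] g) (hφ : Measurable φ) :
    ∫ ω, g ω * φ (ω k) ∂iidLaw μ = (∫ ω, g ω ∂iidLaw μ) * ∫ x, φ x ∂μ := by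
  have heval : ∫ ω : ℕ → X, φ (ω k) ∂iidLaw μ = ∫ x, φ x ∂μ :=
    (measurePreserving_eval_infinitePi (fun _ : ℕ => μ) k).hasLaw.integral_comp
      hφ.aestronglyMeasurable
  rw [(indepFun_past_eval hg hφ).integral_fun_mul_eq_mul_integral
      (hg.mono ((past X).le k) le_rfl).aestronglyMeasurable
      (hφ.comp (measurable_pi_apply k)).aestronglyMeasurable, heval]

lemma memLp_past_mul_eval (hg : Measurable[past X k] g) (hgL2 : MemLp g 2 (iidLaw μ))
    (hφ : Measurable φ) (hφL2 : MemLp φ 2 μ) :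
    MemLp (fun ω => g ω * φ (ω k)) 2 (iidLaw μ) := by
  have hφk : MemLp (fun ω : ℕ → X => φ (ω k)) 2 (iidLaw μ) :=
    hφL2.comp_measurePreserving (measurePreserving_eval_infinitePi (fun _ : ℕ => μ) k)
  have hmeas : AEStronglyMeasurable (fun ω => g ω * φ (ω k)) (iidLaw μ) :=
    hgL2.1.mul hφk.1
  rw [memLp_two_iff_integrable_sq hmeas]
  simp only [mul_pow]
  exact (indepFun_past_eval (hg.pow_const 2) (hφ.pow_const 2)).integrable_mul
    hgL2.integrable_sq hφk.integrable_sq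

/-- The martingale transform: the gain after `m` rounds of the player who stakes `g k`, decided from
the first `k` observations, on the outcome `φ (ω k)` of round `k`. -/
def transform (g : ℕ → (ℕ → X) → ℝ) (φ : X → ℝ) (m : ℕ) (ω : ℕ → X) : ℝ :=
  ∑ k ∈ Finset.range m, g k ω * φ (ω k)

section Transform

variable {g : ℕ → (ℕ → X) → ℝ} {m : ℕ}

lemma measurable_transform (hg : Adapted (past X) g) (hφ : Measurable φ) (m : ℕ) :
    Measurable[past X m] (transform g φ m) := by
  refine @Finset.measurable_fun_sum _ _ _ _ _ _ (past X m) _ _ fun k hk => ?_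
  have hkm := Finset.mem_range.1 hk
  exact ((hg k).mono ((past X).mono hkm.le) le_rfl).mul (hφ.comp (measurable_past_eval hkm))

lemma memLp_transform (hg : Adapted (past X) g) (hgL2 : ∀ k, MemLp (g k) 2 (iidLaw μ))
    (hφ : Measurable φ) (hφL2 : MemLp φ 2 μ) (m : ℕ) :
    MemLp (transform g φ m) 2 (iidLaw μ) :=
  memLp_finsetSum _ fun k _ => memLp_past_mul_eval (hg k) (hgL2 k) hφ hφL2

lemma integral_transform (hg : Adapted (past X) g) (hgL2 : ∀ k, MemLp (g k) 2 (iidLaw μ))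
    (hφ : Measurable φ) (hφL2 : MemLp φ 2 μ) (hφ0 : ∫ x, φ x ∂μ = 0) (m : ℕ) :
    ∫ ω, transform g φ m ω ∂iidLaw μ = 0 := by
  simp only [transform]
  rw [integral_finsetSum _ fun k _ =>
    (memLp_past_mul_eval (hg k) (hgL2 k) hφ hφL2).integrable one_le_two]
  exact Finset.sum_eq_zero fun k _ => by rw [integral_past_mul_eval (hg k) hφ, hφ0, mul_zero]

lemma variance_transform (hg : Adapted (past X) g) (hgL2 : ∀ k, MemLp (g k) 2 (iidLaw μ))
    (hφ : Measurable φ) (hφL2 : MemLp φ 2 μ) (hφ0 : ∫ x, φ x ∂μ = 0) (m : ℕ) :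
    Var[transform g φ m; iidLaw μ] =
      Var[φ; μ] * ∑ k ∈ Finset.range m, ∫ ω, g k ω ^ 2 ∂iidLaw μ := by
  induction m with
  | zero =>
    have hzero : transform g φ 0 = 0 := funext fun ω => Finset.sum_range_zero _
    simp [hzero, variance_zero]
  | succ m ih =>
    have hT := memLp_transform hg hgL2 hφ hφL2 m
    have hZ := memLp_past_mul_eval (hg m) (hgL2 m) hφ hφL2
    have hZ0 : ∫ ω, g m ω * φ (ω m) ∂iidLaw μ = 0 := by
      rw [integral_past_mul_eval (hg m) hφ, hφ0, mul_zero]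
    have hcov : cov[transform g φ m, fun ω => g m ω * φ (ω m); iidLaw μ] = 0 := by
      rw [covariance_eq_sub hT hZ, hZ0, mul_zero, sub_zero]
      have h := integral_past_mul_eval (μ := μ) ((measurable_transform hg hφ m).mul (hg m)) hφ
      simpa only [Pi.mul_apply, ← mul_assoc, hφ0, mul_zero] using h
    have hvar : Var[fun ω => g m ω * φ (ω m); iidLaw μ] =
        (∫ ω, g m ω ^ 2 ∂iidLaw μ) * Var[φ; μ] := by
      rw [variance_of_integral_eq_zero hZ.1.aemeasurable hZ0,
        variance_of_integral_eq_zero hφ.aemeasurable hφ0]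
      simp only [mul_pow]
      exact integral_past_mul_eval ((hg m).pow_const 2) (hφ.pow_const 2)
    have hsucc : transform g φ (m + 1) = transform g φ m + fun ω => g m ω * φ (ω m) :=
      funext fun ω => Finset.sum_range_succ _ _
    rw [hsucc, variance_add hT hZ, ih, hcov, hvar, Finset.sum_range_succ]
    ring

end Transform

end IndependentSequences

section LikelihoodRatio

variable {X : Type*}

/-- The likelihood ratio of the first `k` observations, when `r` is that of a single one. -/
def likelihood (r : X → ℝ) (k : ℕ) (ω : ℕ → X) : ℝ :=
  ∏ i ∈ Finset.range k, r (ω i)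

lemma likelihood_succ (r : X → ℝ) (k : ℕ) (ω : ℕ → X) :
    likelihood r (k + 1) ω = likelihood r k ω * r (ω k) :=
  Finset.prod_range_succ _ _

lemma likelihood_sub_one (r : X → ℝ) (m : ℕ) (ω : ℕ → X) :
    likelihood r m ω - 1 = transform (likelihood r) (fun x => r x - 1) m ω := by
  have hstep (k : ℕ) : likelihood r k ω * (r (ω k) - 1) =
      likelihood r (k + 1) ω - likelihood r k ω := by rw [likelihood_succ]; ring
  rw [transform, Finset.sum_congr rfl fun k _ => hstep k,
    Finset.sum_range_sub fun k => likelihood r k ω, likelihood, likelihood, Finset.prod_range_zero]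

/-- The relative increment `L (min τ m) - 1` of the likelihood ratio `L = likelihood r` up to the
time `min τ m`. -/
noncomputable def score (r : X → ℝ) (τ : (ℕ → X) → ℕ∞) (m : ℕ) : (ℕ → X) → ℝ :=
  transform (fun k => {ω | (k : ℕ∞) < τ ω}.indicator (likelihood r k)) (fun x => r x - 1) m

lemma indicator_mul_likelihood_sub_score (r : X → ℝ) (τ : (ℕ → X) → ℕ∞) (m : ℕ)
    (E : Set (ℕ → X)) (ω : ℕ → X) :
    E.indicator 1 ω * (likelihood r m ω - 1) - E.indicator 1 ω * score r τ m ω =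
      transform (fun k => (E ∩ {ω | τ ω ≤ k}).indicator (likelihood r k))
        (fun x => r x - 1) m ω := by
  simp only [likelihood_sub_one, score, transform, Finset.mul_sum, ← Finset.sum_sub_distrib]
  refine Finset.sum_congr rfl fun k _ => ?_
  by_cases hE : ω ∈ E <;> by_cases hτ : (k : ℕ∞) < τ ω <;>
    simp [Set.indicator, hE, hτ, not_le.2, not_lt.1]

variable [MeasurableSpace X]

/-- `r` is a nonnegative, square integrable density of `ν` with respect to `μ`. -/
structure IsLikelihoodRatio (r : X → ℝ) (μ ν : Measure X) : Prop where
  measurable : Measurable r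
  nonneg : ∀ x, 0 ≤ r x
  memLp : MemLp r 2 μ
  withDensity_eq : μ.withDensity (fun x => ENNReal.ofReal (r x)) = ν

namespace IsLikelihoodRatio

variable {μ ν : Measure X} {r : X → ℝ} {K : ℝ} {m : ℕ}

lemma likelihood_nonneg (hr : IsLikelihoodRatio r μ ν) (k : ℕ) (ω : ℕ → X) :
    0 ≤ likelihood r k ω :=
  Finset.prod_nonneg fun _ _ => hr.nonneg _

lemma likelihood_le_pow (hr : IsLikelihoodRatio r μ ν) (hK : ∀ x, r x ≤ K) (k : ℕ)
    (ω : ℕ → X) : likelihood r k ω ≤ K ^ k := by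
  simpa using! Finset.prod_le_prod (s := Finset.range k) (fun i _ => hr.nonneg (ω i))
    fun i _ => hK (ω i)

lemma adapted_likelihood (hr : IsLikelihoodRatio r μ ν) : Adapted (past X) (likelihood r) :=
  fun k => @Finset.measurable_fun_prod _ _ _ _ _ _ (past X k) _ _ fun _ hi =>
    hr.measurable.comp (measurable_past_eval (Finset.mem_range.1 hi))

lemma integral_eq_one [IsProbabilityMeasure ν] (hr : IsLikelihoodRatio r μ ν) :
    ∫ x, r x ∂μ = 1 := by
  rw [integral_eq_lintegral_of_nonneg_ae (ae_of_all _ hr.nonneg)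
    hr.measurable.aestronglyMeasurable, ← setLIntegral_univ,
    ← withDensity_apply _ MeasurableSet.univ, hr.withDensity_eq, measure_univ, ENNReal.toReal_one]

variable [IsProbabilityMeasure μ]

lemma memLp_sub_one (hr : IsLikelihoodRatio r μ ν) : MemLp (fun x => r x - 1) 2 μ :=
  hr.memLp.sub (memLp_const 1)

lemma memLp_likelihood (hr : IsLikelihoodRatio r μ ν) (k : ℕ) :
    MemLp (likelihood r k) 2 (iidLaw μ) := by
  induction k with
  | zero =>
    have hone : likelihood r 0 = fun _ => 1 := funext fun ω => Finset.prod_range_zero _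
    simpa only [hone] using memLp_const (1 : ℝ)
  | succ k ih =>
    simpa only [← likelihood_succ] using!
      memLp_past_mul_eval (hr.adapted_likelihood k) ih hr.measurable hr.memLp

variable [IsProbabilityMeasure ν]

lemma integral_sub_one (hr : IsLikelihoodRatio r μ ν) : ∫ x, (r x - 1) ∂μ = 0 := by
  rw [integral_sub (hr.memLp.integrable one_le_two) (integrable_const 1), hr.integral_eq_one]
  simp

lemma one_le_bound (hr : IsLikelihoodRatio r μ ν) (hK : ∀ x, r x ≤ K) : 1 ≤ K := by
  simpa [hr.integral_eq_one] using
    integral_mono (hr.memLp.integrable one_le_two) (integrable_const K) hK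

lemma pi_withDensity_eq (hr : IsLikelihoodRatio r μ ν) (ι : Type*) [Fintype ι] :
    (Measure.pi fun _ : ι => μ).withDensity (fun x => ∏ i, ENNReal.ofReal (r (x i))) =
      Measure.pi fun _ : ι => ν := by
  have : IsProbabilityMeasure (μ.withDensity fun x => ENNReal.ofReal (r x)) :=
    hr.withDensity_eq ▸ inferInstance
  rw [pi_withDensity fun _ => hr.measurable.ennreal_ofReal, hr.withDensity_eq]

lemma iidLaw_eq_setLIntegral (hr : IsLikelihoodRatio r μ ν) {A : Set (ℕ → X)}
    (hA : MeasurableSet[past X m] A) :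
    iidLaw ν A = ∫⁻ ω in A, ENNReal.ofReal (likelihood r m ω) ∂iidLaw μ := by
  rw [past_eq_comap_restrict] at hA
  obtain ⟨A, hA, rfl⟩ := hA
  have hrestrict := Finset.measurable_restrict (X := fun _ : ℕ => X) (Finset.range m)
  have hprod : Measurable fun x : Finset.range m → X => ∏ i, ENNReal.ofReal (r (x i)) :=
    Finset.measurable_fun_prod _ fun i _ =>
      hr.measurable.ennreal_ofReal.comp (measurable_pi_apply i)
  calc iidLaw ν ((Finset.range m).restrict ⁻¹' A)
      = Measure.pi (fun _ : Finset.range m => ν) A := by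
        rw [← Measure.map_apply hrestrict hA, Measure.infinitePi_map_restrict]
    _ = ∫⁻ x in A, ∏ i, ENNReal.ofReal (r (x i)) ∂(iidLaw μ).map (Finset.range m).restrict := by
        rw [← hr.pi_withDensity_eq, withDensity_apply _ hA, Measure.infinitePi_map_restrict]
    _ = ∫⁻ ω in (Finset.range m).restrict ⁻¹' A, ∏ i : Finset.range m, ENNReal.ofReal (r (ω i))
          ∂iidLaw μ := setLIntegral_map hA hprod hrestrict
    _ = ∫⁻ ω in (Finset.range m).restrict ⁻¹' A, ENNReal.ofReal (likelihood r m ω) ∂iidLaw μ := by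
        refine lintegral_congr fun ω => ?_
        rw [likelihood, ENNReal.ofReal_prod_of_nonneg fun _ _ => hr.nonneg _,
          Finset.prod_coe_sort (Finset.range m) fun i => ENNReal.ofReal (r (ω i))]

lemma iidLaw_real_eq_setIntegral (hr : IsLikelihoodRatio r μ ν) {A : Set (ℕ → X)}
    (hA : MeasurableSet[past X m] A) :
    (iidLaw ν).real A = ∫ ω in A, likelihood r m ω ∂iidLaw μ := by
  rw [integral_eq_lintegral_of_nonneg_ae (ae_of_all _ (hr.likelihood_nonneg m))
    (hr.memLp_likelihood m).1.restrict, measureReal_def, hr.iidLaw_eq_setLIntegral hA]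

lemma iidLaw_real_le_mul (hr : IsLikelihoodRatio r μ ν) (hK : ∀ x, r x ≤ K) {A : Set (ℕ → X)}
    (hA : MeasurableSet[past X m] A) : (iidLaw ν).real A ≤ K ^ m * (iidLaw μ).real A := by
  rw [hr.iidLaw_real_eq_setIntegral hA]
  calc ∫ ω in A, likelihood r m ω ∂iidLaw μ
      ≤ ∫ _ in A, K ^ m ∂iidLaw μ :=
        integral_mono ((hr.memLp_likelihood m).integrable one_le_two).integrableOn
          (integrable_const _) (hr.likelihood_le_pow hK m)
    _ = K ^ m * (iidLaw μ).real A := by simp [mul_comm]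

end IsLikelihoodRatio

lemma measurableSet_past_lt {τ : (ℕ → X) → ℕ∞} (hτ : IsStoppingTime (past X) τ) (k : ℕ) :
    MeasurableSet[past X k] {ω | (k : ℕ∞) < τ ω} :=
  hτ.measurableSet_gt k

namespace IsLikelihoodRatio

variable {μ ν : Measure X} {r : X → ℝ} {K : ℝ} {m : ℕ} {τ : (ℕ → X) → ℕ∞} {E : Set (ℕ → X)}

lemma adapted_indicator_likelihood (hr : IsLikelihoodRatio r μ ν) {A : ℕ → Set (ℕ → X)}
    (hA : ∀ k, MeasurableSet[past X k] (A k)) :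
    Adapted (past X) fun k => (A k).indicator (likelihood r k) :=
  fun k => (hr.adapted_likelihood k).indicator (hA k)

variable [IsProbabilityMeasure μ]

lemma memLp_indicator_likelihood (hr : IsLikelihoodRatio r μ ν) {A : ℕ → Set (ℕ → X)}
    (hA : ∀ k, MeasurableSet[past X k] (A k)) (k : ℕ) :
    MemLp ((A k).indicator (likelihood r k)) 2 (iidLaw μ) :=
  (hr.memLp_likelihood k).indicator ((past X).le k _ (hA k))

lemma memLp_score (hr : IsLikelihoodRatio r μ ν) (hτ : IsStoppingTime (past X) τ) (m : ℕ) :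
    MemLp (score r τ m) 2 (iidLaw μ) :=
  memLp_transform (hr.adapted_indicator_likelihood (measurableSet_past_lt hτ))
    (hr.memLp_indicator_likelihood (measurableSet_past_lt hτ)) (hr.measurable.sub_const 1)
    hr.memLp_sub_one m

variable [IsProbabilityMeasure ν]

lemma integral_score (hr : IsLikelihoodRatio r μ ν) (hτ : IsStoppingTime (past X) τ) (m : ℕ) :
    ∫ ω, score r τ m ω ∂iidLaw μ = 0 :=
  integral_transform (hr.adapted_indicator_likelihood (measurableSet_past_lt hτ))
    (hr.memLp_indicator_likelihood (measurableSet_past_lt hτ)) (hr.measurable.sub_const 1)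
    hr.memLp_sub_one hr.integral_sub_one m

lemma variance_score (hr : IsLikelihoodRatio r μ ν) (hτ : IsStoppingTime (past X) τ) (m : ℕ) :
    Var[score r τ m; iidLaw μ] = Var[r; μ] *
      ∑ k ∈ Finset.range m, ∫ ω in {ω | (k : ℕ∞) < τ ω}, likelihood r k ω ^ 2 ∂iidLaw μ := by
  rw [score, variance_transform (hr.adapted_indicator_likelihood (measurableSet_past_lt hτ))
    (hr.memLp_indicator_likelihood (measurableSet_past_lt hτ)) (hr.measurable.sub_const 1)
    hr.memLp_sub_one hr.integral_sub_one, variance_sub_const hr.memLp.1]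
  congr 1
  refine Finset.sum_congr rfl fun k _ => ?_
  rw [← integral_indicator ((past X).le k _ (measurableSet_past_lt hτ k))]
  refine integral_congr_ae (ae_of_all _ fun ω => ?_)
  by_cases hω : (k : ℕ∞) < τ ω <;> simp [Set.indicator, hω]

lemma variance_score_le (hr : IsLikelihoodRatio r μ ν) (hK : ∀ x, r x ≤ K)
    (hτ : IsStoppingTime (past X) τ) (m : ℕ) :
    Var[score r τ m; iidLaw μ] ≤ Var[r; μ] *
      ((K ^ m) ^ 2 * ∑ k ∈ Finset.range m, (iidLaw μ).real {ω | (k : ℕ∞) < τ ω}) := by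
  rw [hr.variance_score hτ]
  refine mul_le_mul_of_nonneg_left ?_ (variance_nonneg _ _)
  rw [Finset.mul_sum]
  refine Finset.sum_le_sum fun k hk => ?_
  have hle (ω : ℕ → X) : likelihood r k ω ≤ K ^ m :=
    (hr.likelihood_le_pow hK k ω).trans
      (pow_le_pow_right₀ (hr.one_le_bound hK) (Finset.mem_range.1 hk).le)
  calc ∫ ω in {ω | (k : ℕ∞) < τ ω}, likelihood r k ω ^ 2 ∂iidLaw μ
      ≤ ∫ _ in {ω | (k : ℕ∞) < τ ω}, (K ^ m) ^ 2 ∂iidLaw μ :=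
        integral_mono (hr.memLp_likelihood k).integrable_sq.integrableOn (integrable_const _)
          fun ω => pow_le_pow_left₀ (hr.likelihood_nonneg k ω) (hle ω) 2
    _ = (K ^ m) ^ 2 * (iidLaw μ).real {ω | (k : ℕ∞) < τ ω} := by simp [mul_comm]

lemma integral_indicator_mul_likelihood_sub_one (hr : IsLikelihoodRatio r μ ν)
    (hE : MeasurableSet[past X m] E) :
    ∫ ω, E.indicator 1 ω * (likelihood r m ω - 1) ∂iidLaw μ =
      (iidLaw ν).real E - (iidLaw μ).real E := by
  have hset (ω : ℕ → X) : E.indicator 1 ω * (likelihood r m ω - 1) =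
      E.indicator (fun ω => likelihood r m ω - 1) ω := by
    by_cases hω : ω ∈ E <;> simp [hω]
  simp only [hset]
  rw [integral_indicator ((past X).le m _ hE), hr.iidLaw_real_eq_setIntegral hE,
    integral_sub ((hr.memLp_likelihood m).integrable one_le_two).integrableOn
      (integrable_const _)]
  simp

/-- After `τ` the likelihood ratio is still a martingale, so that its increments do not correlate
with an event known at time `τ`. -/
lemma integral_indicator_mul_score (hr : IsLikelihoodRatio r μ ν)
    (hτ : IsStoppingTime (past X) τ)
    (hEτ : MeasurableSet[hτ.measurableSpace] E) (hE : MeasurableSet[past X m] E) :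
    ∫ ω, E.indicator 1 ω * score r τ m ω ∂iidLaw μ = (iidLaw ν).real E - (iidLaw μ).real E := by
  have hEmeas : MeasurableSet E := (past X).le m _ hE
  have hE2 : MemLp (E.indicator (1 : (ℕ → X) → ℝ)) 2 (iidLaw μ) :=
    memLp_indicator_const 2 hEmeas 1 (by simp)
  have hL : MemLp (fun ω => likelihood r m ω - 1) 2 (iidLaw μ) :=
    (hr.memLp_likelihood m).sub (memLp_const 1)
  have hstopped := ((hτ.measurableSet E).1 hEτ).2
  have hafter : ∫ ω, (E.indicator 1 ω * (likelihood r m ω - 1) - E.indicator 1 ω * score r τ m ω)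
      ∂iidLaw μ = 0 := by
    simp only [indicator_mul_likelihood_sub_score]
    exact integral_transform (hr.adapted_indicator_likelihood hstopped)
      (hr.memLp_indicator_likelihood hstopped) (hr.measurable.sub_const 1)
      hr.memLp_sub_one hr.integral_sub_one m
  have hsub := integral_sub (hE2.integrable_mul hL) (hE2.integrable_mul (hr.memLp_score hτ m))
  simp only [Pi.mul_apply] at hsub
  rw [hafter, hr.integral_indicator_mul_likelihood_sub_one hE] at hsub
  linarith

theorem sq_real_sub_real_le (hr : IsLikelihoodRatio r μ ν) (hK : ∀ x, r x ≤ K)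
    (hτ : IsStoppingTime (past X) τ)
    (hEτ : MeasurableSet[hτ.measurableSpace] E) (hE : MeasurableSet[past X m] E) :
    ((iidLaw ν).real E - (iidLaw μ).real E) ^ 2 ≤
      Var[r; μ] * ((K ^ m) ^ 2 * ∑ k ∈ Finset.range m, (iidLaw μ).real {ω | (k : ℕ∞) < τ ω}) *
        ((iidLaw μ).real E * (1 - (iidLaw μ).real E)) := by
  have hEmeas : MeasurableSet E := (past X).le m _ hE
  have hE2 : MemLp (E.indicator (1 : (ℕ → X) → ℝ)) 2 (iidLaw μ) :=
    memLp_indicator_const 2 hEmeas 1 (by simp)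
  have hcov : cov[E.indicator 1, score r τ m; iidLaw μ] =
      (iidLaw ν).real E - (iidLaw μ).real E := by
    rw [covariance_eq_sub hE2 (hr.memLp_score hτ m), hr.integral_score hτ, mul_zero, sub_zero]
    exact hr.integral_indicator_mul_score hτ hEτ hE
  have hE0 : 0 ≤ (iidLaw μ).real E * (1 - (iidLaw μ).real E) :=
    mul_nonneg measureReal_nonneg (sub_nonneg.2 measureReal_le_one)
  calc ((iidLaw ν).real E - (iidLaw μ).real E) ^ 2
      ≤ Var[score r τ m; iidLaw μ] * ((iidLaw μ).real E * (1 - (iidLaw μ).real E)) := by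
        rw [← hcov, ← variance_indicator_one hEmeas, mul_comm]
        exact sq_covariance_le hE2 (hr.memLp_score hτ m)
    _ ≤ _ := mul_le_mul_of_nonneg_right (hr.variance_score_le hK hτ m) hE0

end IsLikelihoodRatio

end LikelihoodRatio

lemma IsLikelihoodRatio.comp_fst {X Y : Type*} [MeasurableSpace X] [MeasurableSpace Y]
    {μ ν : Measure X} [SFinite μ] {ρ : Measure Y} [IsProbabilityMeasure ρ] {r : X → ℝ}
    (hr : IsLikelihoodRatio r μ ν) :
    IsLikelihoodRatio (fun x : X × Y => r x.1) (μ.prod ρ) (ν.prod ρ) where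
  measurable := hr.measurable.comp measurable_fst
  nonneg x := hr.nonneg x.1
  memLp := hr.memLp.comp_measurePreserving measurePreserving_fst
  withDensity_eq := by
    rw [← hr.withDensity_eq, prod_withDensity_left hr.measurable.ennreal_ofReal]

section BernoulliInputs

/-- The likelihood ratio of one Bernoulli variable, for the parameter `q` against `p`. -/
noncomputable def bitRatio (p q : I) (b : Bool) : ℝ :=
  bif b then (q : ℝ) / p else (1 - q) / (1 - p)

variable {p q : I}

lemma isLikelihoodRatio_bitRatio (hp : (p : ℝ) ∈ Set.Ioo (0 : ℝ) 1) (q : I) :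
    IsLikelihoodRatio (bitRatio p q) (bernoulliMeasure true false p)
      (bernoulliMeasure true false q) := by
  have hp1 : 0 < 1 - (p : ℝ) := sub_pos.2 hp.2
  have hq1 : (0 : ℝ) ≤ 1 - q := sub_nonneg.2 q.2.2
  have hnonneg (b : Bool) : 0 ≤ bitRatio p q b := by
    cases b
    · exact div_nonneg hq1 hp1.le
    · exact div_nonneg q.2.1 hp.1.le
  refine ⟨measurable_of_finite _, hnonneg, .of_discrete, Measure.ext_of_singleton fun b => ?_⟩
  rw [withDensity_apply _ (measurableSet_singleton b), lintegral_singleton,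
    ← ENNReal.toReal_eq_toReal_iff' (by finiteness) (by finiteness), ENNReal.toReal_mul,
    ENNReal.toReal_ofReal (hnonneg b)]
  cases b
  · simp [bitRatio, hp1.ne']
  · simp [bitRatio, hp.1.ne']

lemma variance_bitRatio (hp : (p : ℝ) ∈ Set.Ioo (0 : ℝ) 1) (q : I) :
    Var[bitRatio p q; bernoulliMeasure true false p] = ((q : ℝ) - p) ^ 2 / (p * (1 - p)) := by
  have hp0 : (p : ℝ) ≠ 0 := hp.1.ne'
  have hp1 : 1 - (p : ℝ) ≠ 0 := (sub_pos.2 hp.2).ne'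
  rw [variance_eq_integral (measurable_of_finite _).aemeasurable,
    (isLikelihoodRatio_bitRatio hp q).integral_eq_one, integral_bernoulliMeasure]
  simp only [bitRatio, cond_true, cond_false, smul_eq_mul]
  field_simp
  simp
  ring

lemma bitRatio_le (hp : (p : ℝ) ∈ Set.Ioo (0 : ℝ) 1) (hpq : p ≤ q) (b : Bool) :
    bitRatio p q b ≤ (q : ℝ) / p := by
  have hpq' : (p : ℝ) ≤ q := hpq
  cases b
  · calc (1 - (q : ℝ)) / (1 - p) ≤ 1 := (div_le_one (sub_pos.2 hp.2)).2 (by linarith)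
      _ ≤ (q : ℝ) / p := (one_le_div hp.1).2 hpq'
  · exact le_rfl

lemma inputLaw_eq_iidLaw (p : I) :
    inputLaw p = iidLaw ((bernoulliMeasure true false p).prod uniform01) := rfl

instance (p : I) : IsProbabilityMeasure (inputLaw p) := by
  rw [inputLaw_eq_iidLaw]
  infer_instance

/-- The likelihood ratio of one input pair `(X_i, U_i)`, for the parameter `q` against `p`. -/
noncomputable def inputRatio (p q : I) (x : Bool × ℝ) : ℝ := bitRatio p q x.1

lemma isLikelihoodRatio_inputRatio (hp : (p : ℝ) ∈ Set.Ioo (0 : ℝ) 1) (q : I) :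
    IsLikelihoodRatio (inputRatio p q) ((bernoulliMeasure true false p).prod uniform01)
      ((bernoulliMeasure true false q).prod uniform01) :=
  (isLikelihoodRatio_bitRatio hp q).comp_fst

lemma variance_inputRatio (hp : (p : ℝ) ∈ Set.Ioo (0 : ℝ) 1) (q : I) :
    Var[inputRatio p q; (bernoulliMeasure true false p).prod uniform01] =
      ((q : ℝ) - p) ^ 2 / (p * (1 - p)) := by
  rw [← variance_bitRatio hp q]
  exact measurePreserving_fst.variance_fun_comp (measurable_of_finite _).aemeasurable

end BernoulliInputs

namespace Algorithm

lemma measurable_past_initial {j k : ℕ} (h : j ≤ k) :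
    Measurable[past (Bool × ℝ) k] fun ω => initial ω j :=
  @measurable_pi_lambda _ _ _ (past _ k) _ _ fun i => measurable_past_eval (i.2.trans_le h)

variable (B : Algorithm)

lemma lt_stopTime_iff (k : ℕ) (ω : ℕ → Bool × ℝ) :
    (k : ℕ∞) < B.stopTime ω ↔ ∀ j ∈ Set.Icc 1 k, ¬B.tau j (initial ω j) = true := by
  refine ⟨fun h j hj ht => ?_, fun h => ?_⟩
  · exact (h.trans_le (iInf₂_le j ⟨hj.1, ht⟩)).not_ge (Nat.cast_le.2 hj.2)
  · refine (Nat.cast_lt.2 k.lt_succ_self).trans_le (le_iInf₂ fun j hj => ?_)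
    by_contra! hlt
    exact h j ⟨hj.1, Nat.lt_succ_iff.1 (Nat.cast_lt.1 hlt)⟩ hj.2

lemma isStoppingTime_stopTime : IsStoppingTime (past (Bool × ℝ)) B.stopTime := by
  intro k
  have hset : {ω | B.stopTime ω ≤ k} =
      ⋃ j ∈ Set.Icc 1 k, {ω | B.tau j (initial ω j) = true} := by
    ext ω
    rw [Set.mem_ofPred_eq, ← not_lt, lt_stopTime_iff]
    simp only [not_forall, not_not, exists_prop, Set.mem_iUnion, Set.mem_ofPred_eq]
  change MeasurableSet[past _ k] {ω | B.stopTime ω ≤ k}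
  rw [hset]
  exact MeasurableSet.biUnion (Set.to_countable _) fun j hj =>
    ((B.measurable_tau j).comp (measurable_past_initial hj.2)) (measurableSet_singleton true)

lemma measurableSet_lt_stopTime (k : ℕ) : MeasurableSet {ω | (k : ℕ∞) < B.stopTime ω} :=
  (past _).le k _ (measurableSet_past_lt B.isStoppingTime_stopTime k)

/-- The event that the algorithm stops within `m` inputs and outputs `1`. -/
def accepted (m : ℕ) : Set (ℕ → Bool × ℝ) := {ω | B.output ω = true ∧ B.stopTime ω ≤ m}

lemma accepted_eq_biUnion (m : ℕ) :
    B.accepted m = ⋃ j ∈ Set.Iic m,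
      {ω | B.stopTime ω = j} ∩ {ω | B.gamma j (initial ω j) = true} := by
  ext ω
  simp only [accepted, output, Set.mem_ofPred_eq, Set.mem_iUnion, Set.mem_Iic, Set.mem_inter_iff,
    exists_prop]
  constructor
  · rintro ⟨hout, hle⟩
    obtain ⟨n, hn⟩ := ENat.ne_top_iff_exists.1 (ne_top_of_le_ne_top (ENat.natCast_ne_top m) hle)
    rw [← hn] at hout hle
    exact ⟨n, Nat.cast_le.1 hle, hn.symm, hout⟩
  · rintro ⟨j, hj, hstopTime, hout⟩
    rw [hstopTime]
    exact ⟨hout, Nat.cast_le.2 hj⟩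

lemma measurableSet_past_accepted (m : ℕ) : MeasurableSet[past _ m] (B.accepted m) := by
  rw [accepted_eq_biUnion]
  refine MeasurableSet.biUnion (Set.to_countable _) fun j hj => MeasurableSet.inter ?_ ?_
  · exact (past _).mono hj _ (B.isStoppingTime_stopTime.measurableSet_eq j)
  · exact ((B.measurable_gamma j).comp (measurable_past_initial hj)) (measurableSet_singleton true)

lemma measurableSet_stopTime_accepted (m : ℕ) :
    MeasurableSet[B.isStoppingTime_stopTime.measurableSpace] (B.accepted m) := by
  refine (B.isStoppingTime_stopTime.measurableSet _).2
    ⟨le_iSup (past _) m _ (B.measurableSet_past_accepted m), fun k => ?_⟩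
  have hinter : B.accepted m ∩ {ω | B.stopTime ω ≤ k} = B.accepted (min m k) := by
    ext ω
    simp only [accepted, Set.mem_inter_iff, Set.mem_ofPred_eq, and_assoc,
      (Nat.mono_cast (α := ℕ∞)).map_min, le_min_iff]
  change MeasurableSet[past _ k] (B.accepted m ∩ {ω | B.stopTime ω ≤ k})
  rw [hinter]
  exact (past _).mono (min_le_right m k) _ (B.measurableSet_past_accepted (min m k))

lemma abs_real_output_sub_real_accepted_le (p : I) (m : ℕ) :
    |(inputLaw p).real {ω | B.output ω = true} - (inputLaw p).real (B.accepted m)| ≤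
      (inputLaw p).real {ω | (m : ℕ∞) < B.stopTime ω} := by
  have hsub : B.accepted m ⊆ {ω | B.output ω = true} := fun _ hω => hω.1
  have hcover : {ω | B.output ω = true} ⊆ B.accepted m ∪ {ω | (m : ℕ∞) < B.stopTime ω} :=
    fun ω hω => (le_or_gt (B.stopTime ω) m).imp (fun h => ⟨hω, h⟩) id
  rw [abs_of_nonneg (sub_nonneg.2 (measureReal_mono hsub)), sub_le_iff_le_add']
  exact (measureReal_mono hcover).trans (measureReal_union_le _ _)

variable {p q : I}

lemma real_lt_stopTime_le_mul (hp : (p : ℝ) ∈ Set.Ioo (0 : ℝ) 1) (hpq : p ≤ q) (m : ℕ) :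
    (inputLaw q).real {ω | (m : ℕ∞) < B.stopTime ω} ≤
      ((q : ℝ) / p) ^ m * (inputLaw p).real {ω | (m : ℕ∞) < B.stopTime ω} :=
  (isLikelihoodRatio_inputRatio hp q).iidLaw_real_le_mul (fun x => bitRatio_le hp hpq x.1)
    (measurableSet_past_lt B.isStoppingTime_stopTime m)

lemma sq_real_accepted_sub_le (hp : (p : ℝ) ∈ Set.Ioo (0 : ℝ) 1) (hpq : p ≤ q)
    (hN : B.meanInputs p ≠ ∞) (m : ℕ) :
    ((inputLaw q).real (B.accepted m) - (inputLaw p).real (B.accepted m)) ^ 2 ≤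
      ((q : ℝ) - p) ^ 2 / (p * (1 - p)) *
        ((((q : ℝ) / p) ^ m) ^ 2 * (B.meanInputs p).toReal) *
        ((inputLaw p).real (B.accepted m) * (1 - (inputLaw p).real (B.accepted m))) := by
  have hE0 : 0 ≤ (inputLaw p).real (B.accepted m) * (1 - (inputLaw p).real (B.accepted m)) :=
    mul_nonneg measureReal_nonneg (sub_nonneg.2 measureReal_le_one)
  have hp0 : 0 ≤ (p : ℝ) * (1 - p) := mul_nonneg hp.1.le (sub_nonneg.2 hp.2.le)
  have hstopped := (isLikelihoodRatio_inputRatio hp q).sq_real_sub_real_le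
    (fun x => bitRatio_le hp hpq x.1) B.isStoppingTime_stopTime
    (B.measurableSet_stopTime_accepted m) (B.measurableSet_past_accepted m)
  rw [variance_inputRatio hp q, ← inputLaw_eq_iidLaw, ← inputLaw_eq_iidLaw] at hstopped
  refine hstopped.trans ?_
  gcongr
  exact sum_measureReal_lt_le_toReal B.measurableSet_lt_stopTime hN m

lemma abs_real_output_sub_diff_accepted_le (hp : (p : ℝ) ∈ Set.Ioo (0 : ℝ) 1) (hpq : p ≤ q)
    (m : ℕ) :
    |((inputLaw q).real (B.accepted m) - (inputLaw p).real (B.accepted m)) -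
        ((inputLaw q).real {ω | B.output ω = true} - (inputLaw p).real {ω | B.output ω = true})| ≤
      (((q : ℝ) / p) ^ m + 1) * (inputLaw p).real {ω | (m : ℕ∞) < B.stopTime ω} := by
  have hP := abs_le.1 (B.abs_real_output_sub_real_accepted_le p m)
  have hQ := abs_le.1 ((B.abs_real_output_sub_real_accepted_le q m).trans
    (B.real_lt_stopTime_le_mul hp hpq m))
  rw [abs_le]
  constructor <;> linarith

end Algorithm

section Perturbation

lemma exists_tendsto_zero_div_tendsto_zero {b : ℕ → ℝ} (hb0 : ∀ m, 0 ≤ b m)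
    (hb : Tendsto b atTop (𝓝 0)) :
    ∃ s : ℕ → ℝ, (∀ m, 0 < s m) ∧ Tendsto s atTop (𝓝 0) ∧
      Tendsto (fun m => b m / s m) atTop (𝓝 0) := by
  have hsqrt : Tendsto (fun m => √(b m)) atTop (𝓝 0) := by simpa using hb.sqrt
  have hpos (m : ℕ) : 0 < √(b m) + 1 / ((m : ℝ) + 1) := by positivity
  refine ⟨fun m => √(b m) + 1 / ((m : ℝ) + 1), hpos, ?_, ?_⟩
  · simpa using hsqrt.add tendsto_one_div_add_atTop_nhds_zero_nat
  · refine squeeze_zero (fun m => div_nonneg (hb0 m) (hpos m).le) (fun m => ?_) hsqrt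
    rw [div_le_iff₀ (hpos m)]
    calc b m = √(b m) * √(b m) := (Real.mul_self_sqrt (hb0 m)).symm
      _ ≤ √(b m) * (√(b m) + 1 / ((m : ℝ) + 1)) :=
        mul_le_mul_of_nonneg_left (le_add_of_nonneg_right (by positivity)) (Real.sqrt_nonneg _)

variable {p : I}

lemma exists_seq_gt_mul_sub_tendsto_zero (hp : (p : ℝ) < 1) {a : ℕ → ℝ} (ha0 : ∀ m, 0 ≤ a m)
    (ha : Tendsto (fun m : ℕ => ((m : ℝ) + 1) * a m) atTop (𝓝 0)) :
    ∃ q : ℕ → I, (∀ m, p < q m) ∧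
      Tendsto (fun m : ℕ => ((m : ℝ) + 1) * ((q m : ℝ) - p)) atTop (𝓝 0) ∧
      Tendsto (fun m => a m / ((q m : ℝ) - p)) atTop (𝓝 0) := by
  obtain ⟨s, hs0, hs, has⟩ := exists_tendsto_zero_div_tendsto_zero
    (fun m => mul_nonneg (by positivity) (ha0 m)) ha
  have hp1 : 0 < 1 - (p : ℝ) := sub_pos.2 hp
  have hmin (m : ℕ) : 0 < min (s m) (1 - p) / ((m : ℝ) + 1) :=
    div_pos (lt_min (hs0 m) hp1) (by positivity)
  have hmem (m : ℕ) : (p : ℝ) + min (s m) (1 - p) / ((m : ℝ) + 1) ∈ I := by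
    have hle : min (s m) (1 - (p : ℝ)) / ((m : ℝ) + 1) ≤ 1 - p :=
      (div_le_self (lt_min (hs0 m) hp1).le (by simp)).trans (min_le_right _ _)
    exact ⟨add_nonneg p.2.1 (hmin m).le, by linarith⟩
  have hsub : ∀ᶠ m in atTop, (p : ℝ) + min (s m) (1 - p) / ((m : ℝ) + 1) - p =
      s m / ((m : ℝ) + 1) := by
    filter_upwards [hs.eventually_le_const hp1] with m hm
    rw [min_eq_left hm, add_sub_cancel_left]
  refine ⟨fun m => ⟨_, hmem m⟩, fun m => lt_add_of_pos_right (p : ℝ) (hmin m), ?_, ?_⟩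
  · refine hs.congr' ?_
    filter_upwards [hsub] with m hm
    rw [hm, mul_div_cancel₀ _ (by positivity)]
  · refine has.congr' ?_
    filter_upwards [hsub] with m hm
    rw [hm, div_div_eq_mul_div, mul_comm]

lemma tendsto_of_add_one_mul_sub_tendsto_zero {q : ℕ → I}
    (hq : Tendsto (fun m : ℕ => ((m : ℝ) + 1) * ((q m : ℝ) - p)) atTop (𝓝 0)) :
    Tendsto (fun m => (q m : ℝ)) atTop (𝓝 p) := by
  have h := (hq.mul tendsto_one_div_add_atTop_nhds_zero_nat).const_add (p : ℝ)
  rw [mul_zero, add_zero] at h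
  refine h.congr fun m => ?_
  have hm : (m : ℝ) + 1 ≠ 0 := by positivity
  field_simp
  ring

lemma tendsto_div_pow_one (hp : 0 < (p : ℝ)) {q : ℕ → I}
    (hq : Tendsto (fun m : ℕ => ((m : ℝ) + 1) * ((q m : ℝ) - p)) atTop (𝓝 0)) :
    Tendsto (fun m => ((q m : ℝ) / p) ^ m) atTop (𝓝 1) := by
  have hlim : Tendsto (fun m : ℕ => (m : ℝ) * (((q m : ℝ) - p) / p)) atTop (𝓝 0) := by
    have h := (hq.sub ((tendsto_of_add_one_mul_sub_tendsto_zero hq).sub_const (p : ℝ))).div_const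
      (p : ℝ)
    rw [sub_self, sub_zero, zero_div] at h
    exact h.congr fun m => by ring
  have hpow := Real.tendsto_one_add_pow_exp_of_tendsto hlim
  rw [Real.exp_zero] at hpow
  refine hpow.congr fun m => ?_
  rw [sub_div, div_self hp.ne', add_sub_cancel]

end Perturbation

namespace Algorithm

variable {B : Algorithm} {p : I}

lemma tendsto_real_accepted
    (hN : Tendsto (fun m : ℕ => (inputLaw p).real {ω | (m : ℕ∞) < B.stopTime ω}) atTop (𝓝 0)) :
    Tendsto (fun m => (inputLaw p).real (B.accepted m)) atTop
      (𝓝 ((inputLaw p).real {ω | B.output ω = true})) := by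
  refine tendsto_iff_dist_tendsto_zero.2 (squeeze_zero (fun _ => dist_nonneg) (fun m => ?_) hN)
  rw [dist_comm]
  exact B.abs_real_output_sub_real_accepted_le p m

lemma IsFactory.tendsto_slope_accepted {S : Set ℝ} {f : ℝ → ℝ} {f' : ℝ} (hB : B.IsFactory S f)
    (hp : (p : ℝ) ∈ Set.Ioo (0 : ℝ) 1) (hS : S ∈ 𝓝 (p : ℝ)) (hf : HasDerivAt f f' p) {q : ℕ → I}
    (hpq : ∀ m, p < q m)
    (hq : Tendsto (fun m : ℕ => ((m : ℝ) + 1) * ((q m : ℝ) - p)) atTop (𝓝 0))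
    (hN : Tendsto (fun m : ℕ => (inputLaw p).real {ω | (m : ℕ∞) < B.stopTime ω} /
      ((q m : ℝ) - p)) atTop (𝓝 0)) :
    Tendsto (fun m => ((inputLaw (q m)).real (B.accepted m) - (inputLaw p).real (B.accepted m)) /
      ((q m : ℝ) - p)) atTop (𝓝 f') := by
  have hsub (m : ℕ) : 0 < (q m : ℝ) - p := sub_pos.2 (hpq m)
  have hqp := tendsto_of_add_one_mul_sub_tendsto_zero hq
  have hslope : Tendsto (fun m => ((inputLaw (q m)).real {ω | B.output ω = true} -
      (inputLaw p).real {ω | B.output ω = true}) / ((q m : ℝ) - p)) atTop (𝓝 f') := by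
    have h := (hasDerivAt_iff_tendsto_slope.1 hf).comp (tendsto_nhdsWithin_iff.2
      ⟨hqp, Eventually.of_forall fun m => Subtype.coe_ne_coe.2 (hpq m).ne'⟩)
    refine h.congr' ?_
    filter_upwards [hqp.eventually hS] with m hm
    rw [(hB (q m) hm).2, (hB p (mem_of_mem_nhds hS)).2, Function.comp_apply, slope_def_field]
  have herror := ((tendsto_div_pow_one hp.1 hq).add_const 1).mul hN
  rw [mul_zero] at herror
  refine hslope.congr_dist (squeeze_zero (fun _ => dist_nonneg) (fun m => ?_) herror)
  rw [dist_comm, Real.dist_eq, ← sub_div, abs_div, abs_of_pos (hsub m), ← mul_div_assoc]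
  exact div_le_div_of_nonneg_right
    (B.abs_real_output_sub_diff_accepted_le hp (hpq m).le m) (hsub m).le

lemma IsFactory.sq_deriv_le {S : Set ℝ} {f : ℝ → ℝ} {f' : ℝ} (hB : B.IsFactory S f)
    (hp : (p : ℝ) ∈ Set.Ioo (0 : ℝ) 1) (hS : S ∈ 𝓝 (p : ℝ)) (hf : HasDerivAt f f' p)
    (hN : B.meanInputs p ≠ ∞) :
    f' ^ 2 ≤ (B.meanInputs p).toReal / (p * (1 - p)) * (f p * (1 - f p)) := by
  have htail := tendsto_add_one_mul_measureReal_lt B.measurableSet_lt_stopTime hN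
  obtain ⟨q, hpq, hq, hratio⟩ :=
    exists_seq_gt_mul_sub_tendsto_zero hp.2 (fun _ => measureReal_nonneg) htail
  have htail0 : Tendsto (fun m : ℕ => (inputLaw p).real {ω | (m : ℕ∞) < B.stopTime ω})
      atTop (𝓝 0) :=
    squeeze_zero (fun _ => measureReal_nonneg)
      (fun m => le_mul_of_one_le_left measureReal_nonneg (by simp)) htail
  have haccepted := tendsto_real_accepted htail0
  rw [(hB p (mem_of_mem_nhds hS)).2] at haccepted
  have hupper := ((((tendsto_div_pow_one hp.1 hq).pow 2).mul_const
    (B.meanInputs p).toReal).div_const ((p : ℝ) * (1 - p))).mul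
      (haccepted.mul (haccepted.const_sub 1))
  rw [one_pow, one_mul] at hupper
  refine le_of_tendsto_of_tendsto' ((hB.tendsto_slope_accepted hp hS hf hpq hq hratio).pow 2)
    hupper fun m => ?_
  have hsub : 0 < (q m : ℝ) - p := sub_pos.2 (hpq m)
  rw [div_pow, div_le_iff₀ (pow_pos hsub 2)]
  exact (B.sq_real_accepted_sub_le hp (hpq m).le hN m).trans_eq (by ring)

end Algorithm

end BernoulliFactory

open BernoulliFactory in
theorem mainTheorem3_general {B : Algorithm} {S : Set ℝ} {f : ℝ → ℝ} {f' : ℝ} {p : I}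
    (hB : B.IsFactory S f) (hp : (p : ℝ) ∈ Set.Ioo (0 : ℝ) 1) (hS : S ∈ 𝓝 (p : ℝ))
    (hfp : f p ∈ Set.Ioo (0 : ℝ) 1) (hf : HasDerivAt f f' p) :
    ENNReal.ofReal (f' ^ 2 * ((p : ℝ) * (1 - p) / (f p * (1 - f p)))) ≤ B.meanInputs p := by
  rcases eq_or_ne (B.meanInputs p) ∞ with hN | hN
  · exact hN ▸ le_top
  have hp0 : 0 < (p : ℝ) * (1 - p) := mul_pos hp.1 (sub_pos.2 hp.2)
  have hfp0 : 0 < f p * (1 - f p) := mul_pos hfp.1 (sub_pos.2 hfp.2)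
  have hderiv := hB.sq_deriv_le hp hS hf hN
  rw [div_mul_eq_mul_div, le_div_iff₀ hp0, ← div_le_iff₀ hfp0] at hderiv
  rwa [ENNReal.ofReal_le_iff_le_toReal hN, ← mul_div_assoc]

theorem mainTheorem3 (S : Set ℝ) (hS : IsOpen S) (hS01 : S ⊆ Set.Ioo (0 : ℝ) 1)
    (f : ℝ → ℝ) (hf01 : ∀ p ∈ S, f p ∈ Set.Ioo (0 : ℝ) 1) (hf : DifferentiableOn ℝ f S)
    (B : BernoulliFactory.Algorithm) (hB : B.IsFactory S f) (hfast : B.IsFast S)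
    (p : unitInterval) (hp : (p : ℝ) ∈ S) :
    ENNReal.ofReal
        ((deriv f (p : ℝ)) ^ 2 * ((p : ℝ) * (1 - (p : ℝ)) / (f p * (1 - f p))))
      ≤ B.meanInputs p := by
  exact mainTheorem3_general hB (hS01 hp) (hS.mem_nhds hp) (hf01 p hp)
    (hf.differentiableAt (hS.mem_nhds hp)).hasDerivAt
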